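/- **Setting.** Let $M$ be an oriented 3-manifold with torus boundary, and let $P,Q\subset M$ be compact oriented properly embedded surfaces, meeting transversely, such that $\partial P$ has $p\ge 1$ components, all of one slope $\alpha$ on $\partial M$, $\partial Q$ has $q\ge 1$ components, all of one slope $\beta$, each component of $\partial P$ meets each component of $\partial Q$ in exactly $\Delta=\Delta(\alpha,\beta)\ge 1$ points, and each arc component of $P\cap Q$ is essential in $P$ and in $Q$. Capping off $\partial P$ and $\partial Q$ by disks (the fat vertices) gives closed surfaces $\widehat P$, $\widehat Q$, and the arcs of $P\cap Q$ become the edges of graphs $G_P\subset\widehat P$ and $G_Q\subset\widehat Q$. The theorem concerns the combinatorial structure of these graphs, and is asserted for every pair $G_P,G_Q$ with this structure, which is as follows. *Points and arcs.* The points of $\partial P\cap\partial Q$ are the triples $(i,j,k)$ with $i\in\mathbb Z/p$, $j\in\mathbb Z/q$, $k\in\mathbb Z/\Delta$, the point $(i,j,k)$ lying on component $i$ of $\partial P$ and component $j$ of $\partial Q$. Along component $i$ of $\partial P$ the point after $(i,j,k)$ is $(i,j+1,k)$, but $(i,0,k+1)$ if $j$ is the last label; along component $j$ of $\partial Q$ the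 point after $(i,j,k)$ is $(i+1,j,k)$, but $(0,j,k+r)$ if $i$ is the last label; here $r$ is a fixed unit of $\mathbb Z/\Delta$. (This is the pattern of parallel curves of slopes $(1,0)$ and $(r,\Delta)$ on $\mathbb R^2/\mathbb Z^2$.) Each component of $\partial P$ and of $\partial Q$ has a sign $\pm$, telling whether its boundary orientation is the direction above. The sign of the point $(i,j,k)$ is the product of the signs of $i$ and $j$. The arcs of $P\cap Q$ are given by a bijection from the positive points to the negative points (the two endpoints of an arc of the oriented 1-manifold $P\cap Q$). *Graphs.* $G_P$ has the vertices $i$, with their signs, and $G_Q$ the vertices $j$; each arc gives an edge of $G_P$ and an edge of $G_Q$ between the vertices on which its endpoints lie. The endpoint $(i,j,k)$ has label $j$ in $G_P$ and label $i$ in $G_Q$. The endpoints at a vertex have the cyclic order above, anticlockwise at a positive vertex and clockwise at a negative one. $G_P$ and $G_Q$ lie in closed oriented surfaces $\widehat P$, $\widehat Q$ each component of which contains a vertex; their faces are compact connected orientable surfaces, of any genus and with any positive number of boundary circles. Neither graph has a trivial loop, that is, no disk face of $G_P$ or $G_Q$ is bounded by a single edge and a single corner, a corner being the part of the boundary of a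 fat vertex between two successive edge-endpoints. *Types.* Each corner of $G_P$ runs between labels $j$ and $j+1$ (mod $q$) for some $j$; this is the interval $(j,j+1)$. For a face $D$ of $G_P$, let $[D]\in\mathbb Z^q$ have as $j$-th coordinate the number of corners $(j,j+1)$ of $D$, each counted with the sign of its vertex. A $q$-type is a vector $\tau\in\{\pm1\}^q$. A disk face $D$ represents $\tau$ if (1) for some $\eta=\pm1$, $[D]_j$ has sign $\eta\tau_j$ whenever $[D]_j\neq0$; (2) $\sum_j|[D]_j|\ge2$; and (3) no interval $(j,j+1)$ is a corner of $D$ at two vertices of opposite sign. $G_P$ represents all types if every $q$-type is represented by some disk face of $G_P$. *Webs.* For an integer $k$, a $k$-web in $G_Q$ is a non-empty subgraph $\Lambda$ of $G_Q$ all of whose vertices have the same sign, such that at most $k$ edge-endpoints of $G_Q$ at vertices of $\Lambda$ are not endpoints of edges of $\Lambda$ (so there is none if $k<0$). **Theorem.** Assume that $\Delta>1-\chi(\widehat P)/p$. Then either $G_P$ represents all types, or $G_Q$ contains a $(p-\chi(\widehat P))$-web. -/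

import Mathlib

/-!
Labelled intersection graphs of two surfaces.

`M` is an oriented 3-manifold with torus boundary, `P` and `Q` are compact oriented surfaces properly
embedded in `M`, meeting transversely; the `p` components of `∂P` are parallel curves of one slope
on the torus `∂M`, the `q` components of `∂Q` are parallel curves of another slope, and every
component of `∂P` meets every component of `∂Q` in exactly `Δ` points, `Δ` being the distance of
the two slopes.  The arc components of `P ∩ Q` are the edges of a graph `G_P` in the closed surface
`P̂` obtained by capping off `∂P` with disks (the fat vertices), and of a graph `G_Q` in `Q̂`.
The definitions below are the combinatorial form of this picture: the points of `∂P ∩ ∂Q` with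
their positions on the curves, the pairing of these points by the arcs, and the complementary
regions (faces) of the two graphs in the two closed surfaces.
-/

namespace IntersectionGraphs

/-! ### The curves on the torus -/

/-- The points of `∂P ∩ ∂Q`.  The triple `(i, j, k)` is the `k`-th of the `Δ` points in which the
`i`-th component of `∂P` meets the `j`-th component of `∂Q`.

Concretely, straighten the curves on `ℝ² / ℤ²`: the `i`-th component of `∂P` is the circle
`y = i / p` of slope `(1, 0)`, the `j`-th component of `∂Q` is the circle `Δ x - r y = j / q` of
slope `(r, Δ)`, where `r` is prime to `Δ`, and `(i, j, k)` is the point with `y = i / p` and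
`x = (j / q + k + r i / p) / Δ`.  Components are numbered (from `0`) in the order in which they
appear on the torus. -/
abbrev Point (p q Δ : ℕ) : Type := Fin p × Fin q × ZMod Δ

section Torus

variable {p q Δ : ℕ} [NeZero p] [NeZero q] [NeZero Δ]

/-- The next point along a component of `∂P` (in the direction `(1, 0)`): the next component of
`∂Q` is crossed; after the last one comes the first one again, on the next of the `Δ` rounds. -/
def nextP (p q Δ : ℕ) [NeZero p] [NeZero q] [NeZero Δ] : Equiv.Perm (Point p q Δ) where
  toFun x := (x.1, x.2.1 + 1, if x.2.1 + 1 = 0 then x.2.2 + 1 else x.2.2)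
  invFun x := (x.1, x.2.1 - 1, if x.2.1 = 0 then x.2.2 - 1 else x.2.2)
  left_inv := by
    rintro ⟨i, j, k⟩
    by_cases h : j + 1 = 0 <;> simp [h]
    exact (eq_neg_of_add_eq_zero_left h).symm
  right_inv := by
    rintro ⟨i, j, k⟩
    by_cases h : j = 0 <;> simp [h]

/-- The next point along a component of `∂Q` (in the direction `(r, Δ)`): the next component of
`∂P` is crossed; going once across all the components of `∂P` shifts the position by `r`. -/
def nextQ (p q Δ : ℕ) [NeZero p] [NeZero q] [NeZero Δ] (r : (ZMod Δ)ˣ) :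
    Equiv.Perm (Point p q Δ) where
  toFun x := (x.1 + 1, x.2.1, if x.1 + 1 = 0 then x.2.2 + r else x.2.2)
  invFun x := (x.1 - 1, x.2.1, if x.1 = 0 then x.2.2 - r else x.2.2)
  left_inv := by
    rintro ⟨i, j, k⟩
    by_cases h : i + 1 = 0 <;> simp [h]
    exact (eq_neg_of_add_eq_zero_left h).symm
  right_inv := by
    rintro ⟨i, j, k⟩
    by_cases h : i = 0 <;> simp [h]

end Torus

/-! ### The arcs -/

/-- The arc components of `P ∩ Q`, recorded through their endpoints.

`signP i` says whether the `i`-th component of `∂P`, oriented as boundary of the oriented surface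
`P`, runs in the direction `(1, 0)` on the torus, and similarly `signQ j`, with the direction
`(r, Δ)`.  Hence `signP i * signQ j` is the sign of each intersection point of these two curves.
As `M`, `P`, `Q` are oriented, so is `P ∩ Q`: each arc runs from a point of one sign to
a point of the other sign, and every point of `∂P ∩ ∂Q` is the endpoint of exactly one arc. -/
structure ArcSystem (p q Δ : ℕ) [NeZero p] [NeZero q] [NeZero Δ] where
  /-- the number `r`, prime to `Δ`, with the slopes being `(1, 0)` and `(r, Δ)` -/
  r : (ZMod Δ)ˣ
  /-- the signs of the vertices of `G_P` -/
  signP : Fin p → ℤˣ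
  /-- the signs of the vertices of `G_Q` -/
  signQ : Fin q → ℤˣ
  /-- the arcs, from their initial to their terminal points -/
  arc : {x : Point p q Δ // signP x.1 * signQ x.2.1 = 1} ≃
    {x : Point p q Δ // signP x.1 * signQ x.2.1 = -1}

namespace ArcSystem

variable {p q Δ : ℕ} [NeZero p] [NeZero q] [NeZero Δ] (A : ArcSystem p q Δ)

/-- The sign of an intersection point of `∂P` and `∂Q`. -/
def sign (x : Point p q Δ) : ℤˣ := A.signP x.1 * A.signQ x.2.1

lemma sign_eq_neg_one {x : Point p q Δ} (h : ¬ A.sign x = 1) : A.sign x = -1 :=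
  (Int.units_eq_one_or _).resolve_left h

/-- The other endpoint of the arc that ends at `x`. -/
def otherEnd (x : Point p q Δ) : Point p q Δ :=
  if h : A.sign x = 1 then (A.arc ⟨x, h⟩).1 else (A.arc.symm ⟨x, A.sign_eq_neg_one h⟩).1

lemma otherEnd_involutive : Function.Involutive A.otherEnd := by
  intro x
  by_cases h : A.sign x = 1
  · have h2 : A.sign (A.arc ⟨x, h⟩).1 = -1 := (A.arc ⟨x, h⟩).2
    have h3 : ¬ A.sign (A.arc ⟨x, h⟩).1 = 1 := by rw [h2]; decide
    have e : A.otherEnd x = (A.arc ⟨x, h⟩).1 := by simp [otherEnd, h]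
    rw [e]; simp only [otherEnd, h3, dite_false]
    exact congrArg Subtype.val (A.arc.symm_apply_apply ⟨x, h⟩)
  · have h2 : A.sign (A.arc.symm ⟨x, A.sign_eq_neg_one h⟩).1 = 1 :=
      (A.arc.symm ⟨x, A.sign_eq_neg_one h⟩).2
    have e : A.otherEnd x = (A.arc.symm ⟨x, A.sign_eq_neg_one h⟩).1 := by simp [otherEnd, h]
    rw [e]; simp only [otherEnd, h2, dite_true]
    exact congrArg Subtype.val (A.arc.apply_symm_apply ⟨x, A.sign_eq_neg_one h⟩)

lemma sign_otherEnd (x : Point p q Δ) : A.sign (A.otherEnd x) = - A.sign x := by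
  by_cases h : A.sign x = 1
  · have e : A.otherEnd x = (A.arc ⟨x, h⟩).1 := by simp [otherEnd, h]
    rw [e, h]; exact (A.arc ⟨x, h⟩).2
  · have e : A.otherEnd x = (A.arc.symm ⟨x, A.sign_eq_neg_one h⟩).1 := by simp [otherEnd, h]
    rw [e, A.sign_eq_neg_one h, neg_neg]
    exact (A.arc.symm ⟨x, A.sign_eq_neg_one h⟩).2

/-- The parity rule: the vertices of `G_P` joined by an edge have the same sign if and only if
the vertices of `G_Q` joined by the corresponding edge have opposite signs. -/
lemma parity_rule (x : Point p q Δ) :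
    A.signP (A.otherEnd x).1 = A.signP x.1 ↔ A.signQ (A.otherEnd x).2.1 = - A.signQ x.2.1 := by
  have h := A.sign_otherEnd x
  unfold sign at h
  rcases Int.units_eq_one_or (A.signP (A.otherEnd x).1) with h1 | h1 <;>
  rcases Int.units_eq_one_or (A.signP x.1) with h2 | h2 <;>
  rcases Int.units_eq_one_or (A.signQ (A.otherEnd x).2.1) with h3 | h3 <;>
  rcases Int.units_eq_one_or (A.signQ x.2.1) with h4 | h4 <;>
  simp_all

/-- The pairing of the edge-endpoints given by the edges. -/
def edgePerm : Equiv.Perm (Point p q Δ) := A.otherEnd_involutive.toPerm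

/-- The number of edges (of `G_P`, and of `G_Q`), i.e. the number of arcs. -/
def numEdges : ℕ := Fintype.card {x : Point p q Δ // A.sign x = 1}

/-- The next edge-endpoint in anticlockwise order around a fat vertex of `G_P`.
Around a positive vertex the labels increase anticlockwise, around a negative one clockwise. -/
def rotP : Equiv.Perm (Point p q Δ) where
  toFun x := if A.signP x.1 = 1 then nextP p q Δ x else (nextP p q Δ).symm x
  invFun x := if A.signP x.1 = 1 then (nextP p q Δ).symm x else nextP p q Δ x
  left_inv x := by
    have h1 : (nextP p q Δ x).1 = x.1 := rfl
    have h2 : ((nextP p q Δ).symm x).1 = x.1 := rfl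
    by_cases h : A.signP x.1 = 1 <;> simp [h, h1, h2]
  right_inv x := by
    have h1 : (nextP p q Δ x).1 = x.1 := rfl
    have h2 : ((nextP p q Δ).symm x).1 = x.1 := rfl
    by_cases h : A.signP x.1 = 1 <;> simp [h, h1, h2]

/-- The next edge-endpoint in anticlockwise order around a fat vertex of `G_Q`. -/
def rotQ : Equiv.Perm (Point p q Δ) where
  toFun x := if A.signQ x.2.1 = 1 then nextQ p q Δ A.r x else (nextQ p q Δ A.r).symm x
  invFun x := if A.signQ x.2.1 = 1 then (nextQ p q Δ A.r).symm x else nextQ p q Δ A.r x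
  left_inv x := by
    have h1 : (nextQ p q Δ A.r x).2.1 = x.2.1 := rfl
    have h2 : ((nextQ p q Δ A.r).symm x).2.1 = x.2.1 := rfl
    by_cases h : A.signQ x.2.1 = 1 <;> simp [h, h1, h2]
  right_inv x := by
    have h1 : (nextQ p q Δ A.r x).2.1 = x.2.1 := rfl
    have h2 : ((nextQ p q Δ A.r).symm x).2.1 = x.2.1 := rfl
    by_cases h : A.signQ x.2.1 = 1 <;> simp [h, h1, h2]

end ArcSystem

/-! ### Graphs in closed orientable surfaces -/

/-- A fat graph with set `X` of edge-endpoints lies in an oriented closed surface; `rot x` is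
the endpoint that follows `x` anticlockwise around its vertex, `edge x` is the other endpoint of
the edge of `x`.  The *corner* at `x` is the part of the boundary of the fat vertex from `x`
anticlockwise to `rot x`; corners are written as their first endpoints `x`.  Walking along
the boundary of the graph, after the corner at `x` one follows the edge of `rot x` and arrives at
the corner at `edge (rot x)`. -/
def nextCorner {X : Type} (rot edge : Equiv.Perm X) : Equiv.Perm X := rot.trans edge

/-- The faces of a fat graph in a closed oriented surface, up to homeomorphism.  The boundary
circles of the faces are the orbits of `nextCorner`; each face is a compact connected orientable
surface with non-empty boundary, and so is given by the boundary circles that it has and by its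
genus.  All faces may have any genus and any positive number of boundary circles. -/
structure Faces {X : Type} (rot edge : Equiv.Perm X) where
  /-- the number of faces -/
  num : ℕ
  /-- the face in which a corner lies -/
  face : X → Fin num
  face_surjective : Function.Surjective face
  face_nextCorner : ∀ x, face (nextCorner rot edge x) = face x
  /-- the genus of a face -/
  genus : Fin num → ℕ

namespace Faces

variable {X : Type} {rot edge : Equiv.Perm X} (F : Faces rot edge)

/-- The number of boundary circles of a face. -/
noncomputable def numBoundary (f : Fin F.num) : ℕ :=
  ((fun x : X => Quotient.mk (Equiv.Perm.SameCycle.setoid (nextCorner rot edge)) x) ''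
    {x | F.face x = f}).ncard

/-- The Euler characteristic of a face. -/
noncomputable def chi (f : Fin F.num) : ℤ := 2 - 2 * (F.genus f : ℤ) - (F.numBoundary f : ℤ)

/-- The face `f` is a disk. -/
def IsDisk (f : Fin F.num) : Prop := F.genus f = 0 ∧ F.numBoundary f = 1

/-- No edge is a trivial loop: no disk face is bounded by a single edge (and a single corner).
(If a loop, together with an arc in the boundary of its fat vertex, bounds a disk in the punctured
surface, then an outermost edge in that disk bounds such a face.) -/
def NoTrivialLoop : Prop := ∀ x, F.IsDisk (F.face x) → nextCorner rot edge x ≠ x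

end Faces

/-! ### Pairs of labelled intersection graphs -/

/-- A pair `G_P`, `G_Q` of labelled intersection graphs: the arcs, the embeddings of the graphs
in the closed surfaces `P̂` and `Q̂`, and the condition that each arc is essential in both `P`
and `Q`. -/
structure GraphPair (p q Δ : ℕ) [NeZero p] [NeZero q] [NeZero Δ] extends ArcSystem p q Δ where
  /-- the faces of `G_P` in `P̂` -/
  facesP : Faces toArcSystem.rotP toArcSystem.edgePerm
  /-- the faces of `G_Q` in `Q̂` -/
  facesQ : Faces toArcSystem.rotQ toArcSystem.edgePerm
  noTrivialLoopP : facesP.NoTrivialLoop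
  noTrivialLoopQ : facesQ.NoTrivialLoop

/-! ### Types -/

/-- `a ∈ ℤ^q` represents the `q`-type `τ`. -/
def VecRepresents {q : ℕ} (a : Fin q → ℤ) (τ : Fin q → ℤˣ) : Prop :=
  (∃ η : ℤˣ, ∀ i, a i ≠ 0 → Int.sign (a i) = (η * τ i : ℤˣ)) ∧ 2 ≤ ∑ i, |a i|

namespace GraphPair

variable {p q Δ : ℕ} [NeZero p] [NeZero q] [NeZero Δ] (G : GraphPair p q Δ)

/-- The Euler characteristic of `P̂`: vertices minus edges plus Euler characteristics of faces. -/
noncomputable def chiP : ℤ := (p : ℤ) - G.numEdges + ∑ f, G.facesP.chi f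

/-- The interval of labels `(j, j + 1)` of `G_P` (cyclically; it is denoted by `j`) at the
corner from `x` to `rotP x`: at a positive vertex the label increases from `x` to `rotP x`, at a
negative vertex it decreases. -/
def interval (x : Point p q Δ) : Fin q :=
  if G.signP x.1 = 1 then x.2.1 else (G.rotP x).2.1

open Classical in
/-- The algebraic sum of the corners of a face `D` of `G_P`, in the free abelian group on the
intervals of labels; a corner counts with the sign of its vertex. -/
noncomputable def cornerSum (D : Fin G.facesP.num) (j : Fin q) : ℤ :=
  ∑ x : Point p q Δ, if G.facesP.face x = D ∧ G.interval x = j then (G.signP x.1 : ℤ) else 0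

/-- No interval of labels is a corner of `D` at two vertices of opposite sign. -/
def Coherent (D : Fin G.facesP.num) : Prop :=
  ∀ x y : Point p q Δ, G.facesP.face x = D → G.facesP.face y = D →
    G.interval x = G.interval y → G.signP x.1 = G.signP y.1

/-- The disk face `D` of `G_P` represents the type `τ`. -/
def FaceRepresents (D : Fin G.facesP.num) (τ : Fin q → ℤˣ) : Prop :=
  G.facesP.IsDisk D ∧ VecRepresents (G.cornerSum D) τ ∧ G.Coherent D

/-- `G_P` represents all types. -/
def RepresentsAllTypes : Prop := ∀ τ : Fin q → ℤˣ, ∃ D, G.FaceRepresents D τ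

/-! ### Webs -/

/-- A non-empty subgraph of `G_Q`: a non-empty set of vertices, and a set of edges between
them, given through the set of the endpoints of these edges. -/
structure SubgraphQ where
  verts : Finset (Fin q)
  ends : Finset (Point p q Δ)
  verts_nonempty : verts.Nonempty
  otherEnd_mem : ∀ x ∈ ends, G.otherEnd x ∈ ends
  vert_mem : ∀ x ∈ ends, x.2.1 ∈ verts

/-- A subgraph of `G_Q` is a `k`-web if its vertices all have the same sign and at most `k`
edge-endpoints of `G_Q` at its vertices are not endpoints of its edges. -/
def IsWeb (Λ : G.SubgraphQ) (k : ℤ) : Prop :=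
  (∀ j ∈ Λ.verts, ∀ j' ∈ Λ.verts, G.signQ j = G.signQ j') ∧
  (({x : Point p q Δ | x.2.1 ∈ Λ.verts ∧ x ∉ Λ.ends} : Finset (Point p q Δ)).card : ℤ) ≤ k

end GraphPair

end IntersectionGraphs

/-! Suppose that a type τ is not represented. Give each corner of G_P the sign of its vertex times
the value of τ on its interval. A disk face with constant corner sign would represent τ, and a
cyclic sequence of signs cannot change exactly once, so every disk face has at least two sides of
edges at which the sign changes ("switches"). Hence a face of Euler characteristic χ has at least 2χ
switches, and Euler's formula leaves at most 2(p - χ(P̂)) sides without a switch.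

If τ is constant, the parity rule says that both sides of an edge lack a switch exactly when the
edge joins vertices of opposite sign in G_Q. So the vertices of one sign span a web
(`exists_web_of_const`).

Otherwise τ rises at some labels and falls at others. An edge leaving the set of rises, or the set
of falls, uses up sides without a switch, so at most p - χ(P̂) endpoints leave one of the two sets
(`HasSwitchRegions.sum_le`). If the rises have one sign in G_Q and the falls have one sign, this set
spans a web.

If, say, the falls have mixed signs, pass to a derived type: between successive rises it is
constant, equal to the sign in G_Q of the fall in between. It is not constant and changes at fewer
labels. Keeping only the edges with an end at a rise, one still finds two switches on each disk
region (`HasSwitchRegions.derived`), while the number of edges minus the total Euler characteristic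
of the regions is unchanged. Induction on the number of changes finishes the proof
(`HasSwitchRegions.exists_web`). -/

namespace IntersectionGraphs

/-! ### Regions of a subgraph -/

/-- The complementary regions of the subgraph of a fat graph whose edges have endpoints in `S`.
A region is a union of faces, glued along the edges outside of `S`.  The side of an edge that is
met when leaving its endpoint `y` runs from the corner `rot.symm y` to the corner `edge y`.
A region of Euler characteristic `1` is a disk, which has only one boundary circle; this is
expressed by saying that a function on corners that does not change along the boundary of
the region is constant. -/
structure Regions {X : Type} (rot edge : Equiv.Perm X) (S : Finset X) (ι : Type) where
  /-- the region of a corner -/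
  reg : X → ι
  /-- the Euler characteristic of a region -/
  chi : ι → ℤ
  chi_le_one : ∀ E, chi E ≤ 1
  reg_edge : ∀ y, reg (edge y) = reg (rot.symm y)
  reg_edge_of_notMem : ∀ y, y ∉ S → reg (edge y) = reg y
  eq_of_chi_eq_one : ∀ E, chi E = 1 → ∀ w : X → ℤ,
    (∀ y, y ∉ S → w (rot.symm y) = w y) →
    (∀ y ∈ S, reg (edge y) = E → w (edge y) = w (rot.symm y)) →
    ∀ x y, reg x = E → reg y = E → w x = w y

namespace Regions

variable {X ι : Type} [Fintype X] [DecidableEq X] [Fintype ι] [DecidableEq ι]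
  {rot edge : Equiv.Perm X} {S : Finset X}

/-- Going around the boundary of a region, a function has total change `0`. -/
lemma sum_change_eq_zero (R : Regions rot edge S ι) (E : ι) (w : X → ℤ) :
    ∑ y, (if R.reg (edge y) = E then w (edge y) - w (rot.symm y) else 0) = 0 := by
  -- Both `edge y` and `rot.symm y` run once through the corners of `E` as `y` runs through the
  -- sides of `E`.
  have h1 : ∑ y, (if R.reg (edge y) = E then w (edge y) else 0) =
      ∑ z, (if R.reg z = E then w z else 0) :=
    Equiv.sum_comp edge (fun z => if R.reg z = E then w z else 0)
  have h2 : ∑ y, (if R.reg (edge y) = E then w (rot.symm y) else 0) =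
      ∑ z, (if R.reg z = E then w z else 0) := by
    rw [← Equiv.sum_comp rot.symm fun z => if R.reg z = E then w z else 0]
    exact Finset.sum_congr rfl fun y _ => by rw [R.reg_edge]
  refine Eq.trans ?_ (sub_eq_zero.2 (h1.trans h2.symm))
  rw [← Finset.sum_sub_distrib]
  exact Finset.sum_congr rfl fun y _ => by split_ifs <;> simp

/-- Both endpoints of an edge inside a region contribute to sums over that region. -/
lemma sum_notMem_edge (R : Regions rot edge S ι) (he : Function.Involutive edge) (E : ι)
    (T : Finset X) (hT : ∀ y ∈ T, edge y ∈ T) (hTS : ∀ y ∈ T, y ∉ S) (w : X → ℤ) :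
    ∑ y, (if R.reg (edge y) = E ∧ y ∈ T then w (edge y) else 0) =
      ∑ y, (if R.reg (edge y) = E ∧ y ∈ T then w y else 0) := by
  rw [← Equiv.sum_comp edge (fun y => if R.reg (edge y) = E ∧ y ∈ T then w y else 0)]
  refine Finset.sum_congr rfl fun y _ => ?_
  have hiff : edge y ∈ T ↔ y ∈ T := ⟨fun h => by simpa [he y] using hT _ h, hT y⟩
  by_cases hy : y ∈ T
  · have h1 := R.reg_edge_of_notMem y (hTS y hy)
    simp [hiff, hy, he y, h1]
  · simp [hiff, hy]

/-- If `w` changes at vertices only at endpoints in `S`, then the total change along the sides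
of a region is `0`. -/
lemma sum_side_change_eq_zero (R : Regions rot edge S ι) (he : Function.Involutive edge)
    (hS : ∀ y ∈ S, edge y ∈ S) (E : ι) (w : X → ℤ)
    (hw : ∀ y, y ∉ S → w (rot.symm y) = w y) :
    ∑ y, (if R.reg (edge y) = E ∧ y ∈ S then w (edge y) - w (rot.symm y) else 0) = 0 := by
  have h1 := R.sum_change_eq_zero E w
  -- The two sides of an edge outside `S` lie in one region, and their changes cancel.
  have h2 := R.sum_notMem_edge he E Sᶜ
    (fun y hy => by
      simp only [Finset.mem_compl] at hy ⊢
      exact fun h => hy (by simpa [he y] using hS _ h))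
    (fun y hy => by simpa using hy) w
  rw [← sub_eq_zero, ← Finset.sum_sub_distrib] at h2
  refine Eq.trans ?_ ((congrArg₂ (· - ·) h1 h2).trans (sub_zero 0))
  rw [← Finset.sum_sub_distrib]
  refine Finset.sum_congr rfl fun y _ => ?_
  by_cases hr : R.reg (edge y) = E <;> by_cases hy : y ∈ S <;> simp [hr, hy, hw]

/-- A function cannot change at exactly one side of a region. -/
lemma side_change_eq_zero (R : Regions rot edge S ι) (he : Function.Involutive edge)
    (hS : ∀ y ∈ S, edge y ∈ S) (E : ι) (w : X → ℤ)
    (hw : ∀ y, y ∉ S → w (rot.symm y) = w y) (z : X)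
    (hz : ∀ y ∈ S, y ≠ z → R.reg (edge y) = E → w (edge y) = w (rot.symm y))
    (hzS : z ∈ S) (hzE : R.reg (edge z) = E) : w (edge z) = w (rot.symm z) := by
  have h := R.sum_side_change_eq_zero he hS E w hw
  rw [Finset.sum_eq_single z] at h
  · rw [if_pos ⟨hzE, hzS⟩] at h
    linarith
  · intro y _ hy
    split_ifs with h'
    · rw [hz y h'.2 hy h'.1, sub_self]
    · rfl
  · simp

/-! ### Deletion of edges. -/

/-- Deletion of an edge with the same region on both sides. -/
def deleteSame (R : Regions rot edge S ι) (y : X) (hab : R.reg (edge y) = R.reg y)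
    (he : Function.Involutive edge) : Regions rot edge (S \ {y, edge y}) ι where
  reg := R.reg
  -- Gluing a region to itself along an edge lowers χ by one. The result is never a disk, so the
  -- disk condition is vacuous for it.
  chi := Function.update R.chi (R.reg y) (R.chi (R.reg y) - 1)
  chi_le_one E := by
    have := R.chi_le_one E
    by_cases h : E = R.reg y
    · subst h; simp; linarith
    · simpa [h] using this
  reg_edge := R.reg_edge
  reg_edge_of_notMem z hz := by
    by_cases h1 : z = y
    · rw [h1, hab]
    by_cases h2 : z = edge y
    · rw [h2, he y, hab]
    · exact R.reg_edge_of_notMem z fun h => hz (by simp [h, h1, h2])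
  eq_of_chi_eq_one E hE w hw hs := by
    by_cases h : E = R.reg y
    · subst h
      have := R.chi_le_one (R.reg y)
      simp at hE; omega
    · rw [Function.update_of_ne h] at hE
      refine R.eq_of_chi_eq_one E hE w (fun z hz => hw z fun h => hz (Finset.mem_sdiff.1 h).1)
        fun z hz hzE => hs z ?_ hzE
      have h1 : z ≠ y := by rintro rfl; exact h (hzE.symm.trans hab)
      have h2 : z ≠ edge y := by rintro rfl; exact h (by rw [← hzE, he y])
      simp [hz, h1, h2]

/-- Deletion of an edge with different regions on its two sides. -/
def deleteMerge (R : Regions rot edge S ι) (y : X) (hy : y ∈ S)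
    (hab : R.reg (edge y) ≠ R.reg y) (he : Function.Involutive edge)
    (hS : ∀ y ∈ S, edge y ∈ S) : Regions rot edge (S \ {y, edge y}) ι where
  reg x := if R.reg x = R.reg y then R.reg (edge y) else R.reg x
  -- The merged region takes the index of `edge y`. The index of `y` is left without corners; its
  -- value 0 keeps the total right and imposes no disk condition.
  chi E := if E = R.reg (edge y) then R.chi (R.reg (edge y)) + R.chi (R.reg y) - 1 else
    if E = R.reg y then 0 else R.chi E
  chi_le_one E := by
    have h1 := R.chi_le_one E
    have h2 := R.chi_le_one (R.reg y)
    have h3 := R.chi_le_one (R.reg (edge y))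
    split_ifs <;> linarith
  reg_edge z := by rw [R.reg_edge]
  reg_edge_of_notMem z hz := by
    by_cases h1 : z = y
    · subst h1; simp [hab]
    by_cases h2 : z = edge y
    · subst h2; simp [he y, hab]
    · rw [R.reg_edge_of_notMem z fun h => hz (by simp [h, h1, h2])]
  eq_of_chi_eq_one E hE w hw hs := by
    have hw' : ∀ z, z ∉ S → w (rot.symm z) = w z :=
      fun z hz => hw z fun h => hz (Finset.mem_sdiff.1 h).1
    have hyw : w (rot.symm y) = w y := hw y (by simp)
    have hyw' : w (rot.symm (edge y)) = w (edge y) := hw (edge y) (by simp)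
    by_cases h : E = R.reg (edge y)
    · subst h
      have c1 := R.chi_le_one (R.reg y)
      have c2 := R.chi_le_one (R.reg (edge y))
      simp only [if_true] at hE
      -- A merged disk comes from two disks. On each of them `w` is known not to change at any side
      -- but the deleted one, hence not there either.
      have s1 : w (edge y) = w (rot.symm y) := by
        refine R.side_change_eq_zero he hS (R.reg (edge y)) w hw' y (fun z hz hzy hzE => ?_) hy rfl
        refine hs z ?_ (by rw [hzE, if_neg hab])
        have h2 : z ≠ edge y := by rintro rfl; rw [he y] at hzE; exact hab hzE.symm
        simp [hz, hzy, h2]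
      have s2 : w (edge (edge y)) = w (rot.symm (edge y)) := by
        refine R.side_change_eq_zero he hS (R.reg y) w hw' (edge y) (fun z hz hzy hzE => ?_)
          (hS y hy) (by rw [he y])
        refine hs z ?_ (by rw [hzE, if_pos rfl])
        have h2 : z ≠ y := by rintro rfl; exact hab hzE
        simp [hz, hzy, h2]
      have d1 := R.eq_of_chi_eq_one (R.reg (edge y)) (by linarith) w hw' fun z hz hzE => by
        by_cases hzy : z = y
        · rw [hzy, s1]
        · have h2 : z ≠ edge y := by rintro rfl; rw [he y] at hzE; exact hab hzE.symm
          exact hs z (by simp [hz, hzy, h2]) (by rw [hzE, if_neg hab])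
      have d2 := R.eq_of_chi_eq_one (R.reg y) (by linarith) w hw' fun z hz hzE => by
        by_cases hzy : z = edge y
        · rw [hzy, s2]
        · have h2 : z ≠ y := by rintro rfl; exact hab hzE
          exact hs z (by simp [hz, hzy, h2]) (by rw [hzE, if_pos rfl])
      have key : ∀ x, (if R.reg x = R.reg y then R.reg (edge y) else R.reg x) = R.reg (edge y) →
          w x = w y := by
        intro x hx
        split_ifs at hx with hx'
        · exact d2 x y hx' rfl
        · rw [d1 x (edge y) hx rfl, s1, hyw]
      intro x x' hx hx'
      rw [key x hx, key x' hx']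
    · rw [if_neg h] at hE
      by_cases h' : E = R.reg y
      · rw [if_pos h'] at hE; omega
      rw [if_neg h'] at hE
      have key : ∀ x, (if R.reg x = R.reg y then R.reg (edge y) else R.reg x) = E ↔
          R.reg x = E := by
        intro x
        split_ifs with hx
        · exact ⟨fun e => (h e.symm).elim, fun e => (h' (e.symm.trans hx)).elim⟩
        · rfl
      intro x x' hx hx'
      refine R.eq_of_chi_eq_one E hE w hw' (fun z hz hzE => hs z ?_ ((key _).2 hzE)) x x'
        ((key x).1 hx) ((key x').1 hx')
      have h1 : z ≠ y := by rintro rfl; exact h hzE.symm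
      have h2 : z ≠ edge y := by rintro rfl; rw [he y] at hzE; exact h' hzE.symm
      simp [hz, h1, h2]

lemma sum_pair_indicator {y z : X} (h : z ≠ y) :
    ∑ x : X, (if x = y ∨ x = z then (1 : ℤ) else 0) = 2 := by
  rw [Finset.sum_boole]
  have : (Finset.univ.filter fun x => x = y ∨ x = z) = {y, z} := by ext; simp
  rw [this, Finset.card_pair h.symm]
  rfl

/-- Deletion of an edge. -/
lemma exists_delete (R : Regions rot edge S ι) (he : Function.Involutive edge)
    (hS : ∀ y ∈ S, edge y ∈ S) (y : X) (hy : y ∈ S) (hne : edge y ≠ y) :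
    ∃ R' : Regions rot edge (S \ {y, edge y}) ι,
      2 * ∑ E, R'.chi E = 2 * ∑ E, R.chi E - 2 ∧
      ∀ g : X → ℤ, (∀ E, 2 * R.chi E ≤ ∑ z, if R.reg (edge z) = E then g z else 0) →
        ∀ E, 2 * R'.chi E ≤ ∑ z, if R'.reg (edge z) = E then
          g z - (if z = y ∨ z = edge y then 1 else 0) else 0 := by
  -- In both cases the total χ drops by one and the two sides of the edge lose weight 2 in all,
  -- which preserves lower bounds of weights by 2χ.
  by_cases hab : R.reg (edge y) = R.reg y
  · have hreg : ∀ z, (R.deleteSame y hab he).reg z = R.reg z := fun _ => rfl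
    refine ⟨R.deleteSame y hab he, ?_, fun g hg E => ?_⟩
    · simp only [deleteSame]
      rw [Finset.sum_update_of_mem (Finset.mem_univ _),
        ← Finset.add_sum_erase _ _ (Finset.mem_univ (R.reg y)), Finset.sdiff_singleton_eq_erase]
      ring
    · have h1 := hg E
      simp only [hreg]
      change 2 * Function.update R.chi (R.reg y) (R.chi (R.reg y) - 1) E ≤ _
      by_cases h : E = R.reg y
      · subst h
        have h2 : ∀ z, (if R.reg (edge z) = R.reg y then
            g z - (if z = y ∨ z = edge y then 1 else 0) else 0) =
            (if R.reg (edge z) = R.reg y then g z else 0) -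
            (if z = y ∨ z = edge y then 1 else 0) := by
          intro z
          by_cases h1 : z = y
          · subst h1; simp [hab]
          by_cases h2 : z = edge y
          · subst h2; simp [he y]
          · simp [h1, h2]
        simp only [h2, Finset.sum_sub_distrib, sum_pair_indicator hne, Function.update_self]
        linarith
      · rw [Function.update_of_ne h]
        refine h1.trans (Finset.sum_le_sum fun z _ => ?_)
        by_cases h3 : R.reg (edge z) = E
        · have h4 : ¬(z = y ∨ z = edge y) := by
            rintro (rfl | rfl)
            · exact h (h3.symm.trans hab)
            · rw [he y] at h3; exact h h3.symm
          simp [h3, h4]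
        · simp [h3]
  · have hreg : ∀ z, (R.deleteMerge y hy hab he hS).reg z =
        if R.reg z = R.reg y then R.reg (edge y) else R.reg z := fun _ => rfl
    refine ⟨R.deleteMerge y hy hab he hS, ?_, fun g hg E => ?_⟩
    · simp only [deleteMerge]
      rw [← Finset.add_sum_erase _ _ (Finset.mem_univ (R.reg (edge y))),
        ← Finset.add_sum_erase _ R.chi (Finset.mem_univ (R.reg (edge y))),
        ← Finset.add_sum_erase _ _ (show R.reg y ∈ Finset.univ.erase (R.reg (edge y)) by
          simp [Ne.symm hab]),
        ← Finset.add_sum_erase _ R.chi (show R.reg y ∈ Finset.univ.erase (R.reg (edge y)) by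
          simp [Ne.symm hab])]
      rw [Finset.sum_congr rfl (g := R.chi) (s₂ := (Finset.univ.erase (R.reg (edge y))).erase
        (R.reg y))]
      · simp [Ne.symm hab]; ring
      · intro E hE
        simp only [Finset.mem_erase] at hE
        simp [hE.1, hE.2.1]
    · simp only [hreg]
      change 2 * (if E = R.reg (edge y) then R.chi (R.reg (edge y)) + R.chi (R.reg y) - 1 else
        if E = R.reg y then 0 else R.chi E) ≤ _
      by_cases h : E = R.reg (edge y)
      · subst h
        have h2 : ∀ z, (if (if R.reg (edge z) = R.reg y then R.reg (edge y) else
            R.reg (edge z)) = R.reg (edge y) then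
            g z - (if z = y ∨ z = edge y then 1 else 0) else 0) =
            (if R.reg (edge z) = R.reg (edge y) then g z else 0) +
            (if R.reg (edge z) = R.reg y then g z else 0) -
            (if z = y ∨ z = edge y then 1 else 0) := by
          intro z
          by_cases h1 : z = y
          · subst h1; simp [hab]
          by_cases h2 : z = edge y
          · subst h2; simp [he y, Ne.symm hab]
          · by_cases h3 : R.reg (edge z) = R.reg y
            · simp [h1, h2, h3, Ne.symm hab]
            · simp [h1, h2, h3]
        simp only [h2, Finset.sum_sub_distrib, Finset.sum_add_distrib, sum_pair_indicator hne,
          if_true]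
        have h3 := hg (R.reg y)
        have h4 := hg (R.reg (edge y))
        linarith
      · rw [if_neg h]
        by_cases h' : E = R.reg y
        · rw [if_pos h', Finset.sum_eq_zero]
          · simp
          · intro z _
            rw [if_neg]
            split_ifs with h3
            · exact fun e => h e.symm
            · exact fun e => h3 (e.trans h')
        · rw [if_neg h']
          refine (hg E).trans (Finset.sum_le_sum fun z _ => ?_)
          have key : (if R.reg (edge z) = R.reg y then R.reg (edge y) else R.reg (edge z)) = E ↔
              R.reg (edge z) = E := by
            split_ifs with hx
            · exact ⟨fun e => (h e.symm).elim, fun e => (h' (e.symm.trans hx)).elim⟩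
            · rfl
          simp only [key]
          by_cases h3 : R.reg (edge z) = E
          · have h4 : ¬(z = y ∨ z = edge y) := by
              rintro (rfl | rfl)
              · exact h h3.symm
              · rw [he y] at h3; exact h' h3.symm
            simp [h3, h4]
          · simp [h3]

/-- Deletion of all edges with endpoints outside of `S'`. -/
lemma exists_restrict (he : Function.Involutive edge) (hne : ∀ y, edge y ≠ y) (S' : Finset X)
    (hS' : ∀ y ∈ S', edge y ∈ S') (S : Finset X) (hSS : S' ⊆ S) (hS : ∀ y ∈ S, edge y ∈ S)
    (R : Regions rot edge S ι) :
    ∃ R' : Regions rot edge S' ι,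
      2 * ∑ E, R'.chi E - S'.card = 2 * ∑ E, R.chi E - S.card ∧
      ∀ g : X → ℤ, (∀ E, 2 * R.chi E ≤ ∑ z, if R.reg (edge z) = E then g z else 0) →
        ∀ E, 2 * R'.chi E ≤ ∑ z, if R'.reg (edge z) = E then
          g z - (if z ∈ S ∧ z ∉ S' then 1 else 0) else 0 := by
  induction S using Finset.strongInduction with
  | H S ih =>
  rcases hSS.eq_or_ssubset with rfl | hlt
  · refine ⟨R, rfl, fun g hg E => ?_⟩
    simpa using hg E
  obtain ⟨y, hy, hy'⟩ := Finset.exists_of_ssubset hlt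
  have hey' : edge y ∉ S' := fun h => hy' (by simpa [he y] using hS' _ h)
  obtain ⟨R₁, h₁, hg₁⟩ := R.exists_delete he hS y hy (hne y)
  have hcard : ((S \ {y, edge y}).card : ℤ) = S.card - 2 := by
    have hsub : ({y, edge y} : Finset X) ⊆ S := by
      intro z hz
      simp only [Finset.mem_insert, Finset.mem_singleton] at hz
      rcases hz with rfl | rfl
      exacts [hy, hS _ hy]
    rw [Finset.card_sdiff_of_subset hsub, Finset.card_pair (hne y).symm, Nat.cast_sub]
    · rfl
    · simpa [Finset.card_pair (hne y).symm] using Finset.card_le_card hsub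
  obtain ⟨R', h', hg'⟩ := ih (S \ {y, edge y})
    (Finset.sdiff_ssubset (by
      intro z hz
      simp only [Finset.mem_insert, Finset.mem_singleton] at hz
      rcases hz with rfl | rfl
      exacts [hy, hS _ hy]) ⟨y, by simp⟩)
    (by
      intro z hz
      have h1 : z ≠ y := by rintro rfl; exact hy' hz
      have h2 : z ≠ edge y := by rintro rfl; exact hey' hz
      simp [hSS hz, h1, h2])
    (by
      intro z hz
      simp only [Finset.mem_sdiff, Finset.mem_insert, Finset.mem_singleton, not_or] at hz ⊢
      exact ⟨hS z hz.1, fun h => hz.2.2 (by rw [← h, he z]), fun h => hz.2.1 (edge.injective h)⟩)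
    R₁
  refine ⟨R', by linarith, fun g hg E => (hg' _ (hg₁ g hg) E).trans_eq ?_⟩
  refine Finset.sum_congr rfl fun z _ => ?_
  by_cases h1 : z = y
  · subst h1; simp [hy, hy']
  by_cases h2 : z = edge y
  · subst h2; simp [hS _ hy, hey']
  · simp [h1, h2]

/-! ### Counting switches. -/

/-- A function that changes at fewer than two sides of a disk region is constant there. -/
lemma eq_of_sum_switch_lt_two (R : Regions rot edge S ι) (he : Function.Involutive edge)
    (hS : ∀ y ∈ S, edge y ∈ S) {E : ι} (hE : R.chi E = 1) (w : X → ℤ)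
    (hw : ∀ y, y ∉ S → w (rot.symm y) = w y)
    (hlt : ∑ z, (if R.reg (edge z) = E then
      (if z ∈ S ∧ w (edge z) ≠ w (rot.symm z) then (1 : ℤ) else 0) else 0) < 2) :
    ∀ x y, R.reg x = E → R.reg y = E → w x = w y := by
  simp only [← ite_and, Finset.sum_boole] at hlt
  have hcard : (Finset.univ.filter fun z => R.reg (edge z) = E ∧ z ∈ S ∧
      w (edge z) ≠ w (rot.symm z)).card ≤ 1 := by
    have : ((Finset.univ.filter fun z => R.reg (edge z) = E ∧ z ∈ S ∧
      w (edge z) ≠ w (rot.symm z)).card : ℤ) < 2 := hlt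
    omega
  rw [Finset.card_le_one] at hcard
  refine R.eq_of_chi_eq_one E hE w hw fun y hy hyE => ?_
  by_contra hsw
  refine hsw (R.side_change_eq_zero he hS E w hw y (fun z hz hzy hzE => ?_) hy hyE)
  by_contra hsw'
  exact hzy (hcard z (by simp [hz, hzE, hsw']) y (by simp [hy, hyE, hsw]))

/-- If every region has enough sides at which `w` changes, then few sides remain at which `w`
does not change. -/
lemma sum_nonswitch_le (R : Regions rot edge S ι) (w : X → ℤ)
    (hR : ∀ E, 2 * R.chi E ≤ ∑ z, if R.reg (edge z) = E then
      (if z ∈ S ∧ w (edge z) ≠ w (rot.symm z) then (1 : ℤ) else 0) else 0) :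
    ∑ z, (if z ∈ S ∧ w (edge z) = w (rot.symm z) then (1 : ℤ) else 0) ≤
      S.card - 2 * ∑ E, R.chi E := by
  have h1 := Finset.sum_le_sum fun E (_ : E ∈ Finset.univ) => hR E
  -- Each side lies in exactly one region, so the sum over the regions counts each switch once.
  rw [← Finset.mul_sum, Finset.sum_comm] at h1
  simp only [Finset.sum_ite_eq, Finset.mem_univ, if_true] at h1
  have h2 : (S.card : ℤ) = ∑ z, if z ∈ S then (1 : ℤ) else 0 := by simp
  rw [h2, le_sub_iff_add_le]
  refine (add_le_add_right h1 _).trans_eq ?_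
  rw [← Finset.sum_add_distrib]
  refine Finset.sum_congr rfl fun z _ => ?_
  by_cases hz : z ∈ S <;> by_cases hs : w (edge z) = w (rot.symm z) <;> simp [hz, hs]

end Regions

/-- Comparison of sums over edge-endpoints, edge by edge. -/
lemma sum_le_sum_of_edge {X : Type} [Fintype X] (edge : Equiv.Perm X) (f g : X → ℤ)
    (h : ∀ z, f z + f (edge z) ≤ g z + g (edge z)) : ∑ z, f z ≤ ∑ z, g z := by
  have h1 := Finset.sum_le_sum fun z (_ : z ∈ Finset.univ) => h z
  rw [Finset.sum_add_distrib, Finset.sum_add_distrib, Equiv.sum_comp edge f,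
    Equiv.sum_comp edge g] at h1
  linarith

/-! ### Cyclic sequences of signs -/

section Cyclic

variable {q : ℕ} [NeZero q]

/-- The signs of a type change from `-1` to `1` at the label `j`. -/
def Rises (σ : Fin q → ℤˣ) (j : Fin q) : Prop := σ (j - 1) = -1 ∧ σ j = 1

/-- The signs of a type change from `1` to `-1` at the label `j`. -/
def Falls (σ : Fin q → ℤˣ) (j : Fin q) : Prop := σ (j - 1) = 1 ∧ σ j = -1

instance (σ : Fin q → ℤˣ) : DecidablePred (Rises σ) := fun _ => inferInstanceAs (Decidable (_ ∧ _))

instance (σ : Fin q → ℤˣ) : DecidablePred (Falls σ) := fun _ => inferInstanceAs (Decidable (_ ∧ _))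

lemma rises_neg {σ : Fin q → ℤˣ} {j : Fin q} : Rises (-σ) j ↔ Falls σ j := by
  simp [Rises, Falls, neg_eq_iff_eq_neg]

lemma falls_neg {σ : Fin q → ℤˣ} {j : Fin q} : Falls (-σ) j ↔ Rises σ j := by
  simp [Rises, Falls, neg_eq_iff_eq_neg]

lemma eq_of_not_rises_of_not_falls {σ : Fin q → ℤˣ} {j : Fin q} (h1 : ¬ Rises σ j)
    (h2 : ¬ Falls σ j) : σ (j - 1) = σ j := by
  unfold Rises at h1
  unfold Falls at h2
  rcases Int.units_eq_one_or (σ (j - 1)) with h | h <;>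
  rcases Int.units_eq_one_or (σ j) with h' | h' <;> simp_all

lemma Rises.not_falls {σ : Fin q → ℤˣ} {j : Fin q} (h : Rises σ j) : ¬ Falls σ j := by
  intro h'
  have := h.2.symm.trans h'.2
  exact absurd this (by decide)

lemma exists_iterate_add_one (j j₀ : Fin q) : ∃ n : ℕ, (· + 1)^[n] j = j₀ := by
  refine ⟨(j₀ - j).val, ?_⟩
  have h : ∀ (n : ℕ) (x : Fin q), ((· + 1)^[n] x) = Fin.ofNat q (x.val + n) := by
    intro n
    induction n with
    | zero => intro x; ext; simp
    | succ n ih =>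
      intro x
      rw [Function.iterate_succ_apply, ih]
      ext
      simp [Fin.val_add, Nat.add_assoc, Nat.add_comm 1 n]
  rw [h]
  have h2 := congrArg Fin.val (add_sub_cancel j j₀)
  rw [Fin.val_add] at h2
  ext
  simpa using h2

lemma exists_iterate_sub_one (j j₀ : Fin q) : ∃ n : ℕ, (· - 1)^[n] j = j₀ := by
  obtain ⟨n, hn⟩ := exists_iterate_add_one j₀ j
  refine ⟨n, ?_⟩
  rw [← hn]
  exact Function.LeftInverse.iterate (f := (· + (1 : Fin q))) (g := (· - (1 : Fin q)))
    (fun x => add_sub_cancel_right x 1) n j₀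

/-- The first point of the orbit of `j` at which `P` holds. -/
lemma exists_search {α : Type} (e : α → α) (P : α → Prop) (h : ∀ j, ∃ n : ℕ, P (e^[n] j)) :
    ∃ t : α → α, (∀ j, P j → t j = j) ∧ ∀ j, ¬ P j → t j = t (e j) := by
  classical
  refine ⟨fun j => e^[Nat.find (h j)] j, fun j hj => ?_, fun j hj => ?_⟩
  · have : Nat.find (h j) = 0 := (Nat.find_eq_zero _).2 hj
    simp [this]
  · have : Nat.find (h j) = Nat.find (h (e j)) + 1 :=
      Nat.find_comp_succ (h j) (h (e j)) hj
    simp only [this, Function.iterate_succ_apply]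

/-- Without a rise, a value -1 would propagate forward to all labels. -/
lemma exists_rises {σ : Fin q → ℤˣ} (h1 : ∃ j, σ j = 1) (h2 : ∃ j, σ j = -1) :
    ∃ j, Rises σ j := by
  by_contra! h
  obtain ⟨j₀, hj₀⟩ := h2
  obtain ⟨j₁, hj₁⟩ := h1
  have hn : ∀ n : ℕ, σ ((· + 1)^[n] j₀) = -1 := by
    intro n
    induction n with
    | zero => exact hj₀
    | succ n ih =>
      rw [Function.iterate_succ_apply']
      rcases Int.units_eq_one_or (σ ((· + 1)^[n] j₀ + 1)) with h' | h'
      · exact (h _ ⟨by rw [add_sub_cancel_right, ih], h'⟩).elim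
      · exact h'
  obtain ⟨n, hn'⟩ := exists_iterate_add_one j₀ j₁
  have := hn n
  rw [hn', hj₁] at this
  exact absurd this (by decide)

lemma exists_falls {σ : Fin q → ℤˣ} (h1 : ∃ j, σ j = 1) (h2 : ∃ j, σ j = -1) :
    ∃ j, Falls σ j := by
  obtain ⟨j, hj⟩ := exists_rises (σ := -σ) (h2.imp fun j h => by simp [h])
    (h1.imp fun j h => by simp [h])
  exact ⟨j, rises_neg.1 hj⟩

/-- The derived type: between two successive rises of `σ` it is constant, and equal to the value
of `s` at the fall of `σ` in between. -/
lemma exists_derived {σ : Fin q → ℤˣ} (h1 : ∃ j, σ j = 1) (h2 : ∃ j, σ j = -1) (s : Fin q → ℤˣ) :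
    ∃ σ' : Fin q → ℤˣ, (∀ j, ¬ Rises σ j → σ' (j - 1) = σ' j) ∧ ∀ j, Falls σ j → σ' j = s j := by
  obtain ⟨j₁, h1⟩ := h1
  obtain ⟨j₂, h2⟩ := h2
  -- `t` looks forward for the first -1 and `u` backward for the last 1. The fall in the block of
  -- `j` between two rises is `t j` if `σ j = 1`, and `u j + 1` if `σ j = -1`.
  obtain ⟨t, ht, ht'⟩ := exists_search (· + 1) (fun j => σ j = -1) fun j =>
    (exists_iterate_add_one j j₂).imp fun n hn => by rw [hn, h2]
  obtain ⟨u, hu, hu'⟩ := exists_search (· - 1) (fun j => σ j = 1) fun j =>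
    (exists_iterate_sub_one j j₁).imp fun n hn => by rw [hn, h1]
  have hne : (1 : ℤˣ) ≠ -1 := by decide
  have fall : ∀ j, Falls σ j → s (u j + 1) = s j := by
    intro j hj
    rw [hu' j (by rw [hj.2]; exact hne.symm), hu _ hj.1, sub_add_cancel]
  refine ⟨fun j => if σ j = 1 then s (t j) else s (u j + 1), fun j hj => ?_, fun j hj => ?_⟩
  · rcases Int.units_eq_one_or (σ (j - 1)) with h | h <;>
    rcases Int.units_eq_one_or (σ j) with h' | h'
    · simp only [h, h', if_true]
      rw [ht' (j - 1) (by rw [h]; exact hne), sub_add_cancel]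
    · simp only [h, h', if_true, hne.symm, if_false]
      rw [ht' (j - 1) (by rw [h]; exact hne), sub_add_cancel, ht j h', fall j ⟨h, h'⟩]
    · exact (hj ⟨h, h'⟩).elim
    · simp only [h, h', hne.symm, if_false]
      rw [hu' j (by rw [h']; exact hne.symm)]
  · simp only [hj.2, hne.symm, if_false]
    exact fall j hj

end Cyclic

namespace GraphPair

variable {p q Δ : ℕ} [NeZero p] [NeZero q] [NeZero Δ] (G : GraphPair p q Δ)

/-! ### Corners, types and switches -/

/-- The sign of a type at a corner, multiplied by the sign of the vertex. -/
def cornerSign (σ : Fin q → ℤˣ) (x : Point p q Δ) : ℤ := (G.signP x.1 * σ (G.interval x) : ℤˣ)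

lemma rotP_symm_fst (y : Point p q Δ) : (G.rotP.symm y).1 = y.1 := by
  change (if G.signP y.1 = 1 then (nextP p q Δ).symm y else nextP p q Δ y).1 = y.1
  split_ifs <;> rfl

lemma cornerSign_of_pos (σ : Fin q → ℤˣ) {y : Point p q Δ} (h : G.signP y.1 = 1) :
    G.cornerSign σ (G.rotP.symm y) = σ (y.2.1 - 1) ∧ G.cornerSign σ y = σ y.2.1 := by
  have h1 : G.rotP.symm y = (nextP p q Δ).symm y := by
    change (if G.signP y.1 = 1 then (nextP p q Δ).symm y else nextP p q Δ y) = _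
    rw [if_pos h]
  have h2 := G.rotP_symm_fst y
  constructor
  · unfold cornerSign interval
    rw [h2, if_pos h, h, one_mul, h1]
    rfl
  · unfold cornerSign interval
    rw [if_pos h, h, one_mul]

lemma cornerSign_of_neg (σ : Fin q → ℤˣ) {y : Point p q Δ} (h : G.signP y.1 ≠ 1) :
    G.cornerSign σ (G.rotP.symm y) = -σ y.2.1 ∧ G.cornerSign σ y = -σ (y.2.1 - 1) := by
  have h1 : G.rotP y = (nextP p q Δ).symm y := by
    change (if G.signP y.1 = 1 then nextP p q Δ y else (nextP p q Δ).symm y) = _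
    rw [if_neg h]
  have h2 := G.rotP_symm_fst y
  have h3 : G.signP y.1 = -1 := (Int.units_eq_one_or _).resolve_left h
  constructor
  · unfold cornerSign interval
    rw [h2, if_neg h, h3, Equiv.apply_symm_apply]
    simp
  · unfold cornerSign interval
    rw [if_neg h, h3, h1]
    simp [nextP]

lemma cornerSign_eq_or (σ : Fin q → ℤˣ) (x : Point p q Δ) :
    G.cornerSign σ x = 1 ∨ G.cornerSign σ x = -1 := by
  unfold cornerSign
  rcases Int.units_eq_one_or (G.signP x.1 * σ (G.interval x)) with h | h <;> simp [h]

/-- At a negative vertex the order of the two corners is reversed and so are their signs. These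
effects cancel: a rise looks the same at all vertices. -/
lemma cornerSign_of_rises {σ : Fin q → ℤˣ} {y : Point p q Δ} (h : Rises σ y.2.1) :
    G.cornerSign σ (G.rotP.symm y) = -1 ∧ G.cornerSign σ y = 1 := by
  by_cases hP : G.signP y.1 = 1
  · simp [G.cornerSign_of_pos σ hP, h.1, h.2]
  · simp [G.cornerSign_of_neg σ hP, h.1, h.2]

lemma cornerSign_of_falls {σ : Fin q → ℤˣ} {y : Point p q Δ} (h : Falls σ y.2.1) :
    G.cornerSign σ (G.rotP.symm y) = 1 ∧ G.cornerSign σ y = -1 := by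
  by_cases hP : G.signP y.1 = 1
  · simp [G.cornerSign_of_pos σ hP, h.1, h.2]
  · simp [G.cornerSign_of_neg σ hP, h.1, h.2]

lemma cornerSign_of_eq {σ : Fin q → ℤˣ} {y : Point p q Δ} (h : σ (y.2.1 - 1) = σ y.2.1) :
    G.cornerSign σ (G.rotP.symm y) = G.cornerSign σ y ∧
      G.cornerSign σ y = (G.signP y.1 * σ y.2.1 : ℤˣ) := by
  by_cases hP : G.signP y.1 = 1
  · simp [G.cornerSign_of_pos σ hP, h, hP]
  · have h3 : G.signP y.1 = -1 := (Int.units_eq_one_or _).resolve_left hP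
    simp [G.cornerSign_of_neg σ hP, h, h3]

lemma cornerSign_neg (σ : Fin q → ℤˣ) (x : Point p q Δ) :
    G.cornerSign (-σ) x = -G.cornerSign σ x := by
  simp [cornerSign]

lemma edgePerm_involutive : Function.Involutive G.edgePerm := G.otherEnd_involutive

lemma edgePerm_ne (y : Point p q Δ) : G.edgePerm y ≠ y := by
  intro h
  have h1 := G.sign_otherEnd y
  change G.sign (G.edgePerm y) = _ at h1
  rw [h] at h1
  rcases Int.units_eq_one_or (G.sign y) with h2 | h2 <;> rw [h2] at h1 <;>
    exact absurd h1 (by decide)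

/-! ### The faces as regions -/

lemma one_le_numBoundary (f : Fin G.facesP.num) : 1 ≤ G.facesP.numBoundary f := by
  obtain ⟨x, hx⟩ := G.facesP.face_surjective f
  exact (Set.ncard_pos (Set.toFinite _)).2 ⟨_, x, hx, rfl⟩

lemma isDisk_of_chi_eq_one {f : Fin G.facesP.num} (h : G.facesP.chi f = 1) :
    G.facesP.IsDisk f := by
  have h1 := G.one_le_numBoundary f
  unfold Faces.chi at h
  constructor <;> omega

lemma sameCycle_of_isDisk {f : Fin G.facesP.num} (h : G.facesP.IsDisk f) {x y : Point p q Δ}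
    (hx : G.facesP.face x = f) (hy : G.facesP.face y = f) :
    (nextCorner G.rotP G.edgePerm).SameCycle x y := by
  obtain ⟨a, ha⟩ := Set.ncard_eq_one.1 h.2
  have h1 : Quotient.mk (Equiv.Perm.SameCycle.setoid (nextCorner G.rotP G.edgePerm)) x ∈
      ({a} : Set _) := ha ▸ ⟨x, hx, rfl⟩
  have h2 : Quotient.mk (Equiv.Perm.SameCycle.setoid (nextCorner G.rotP G.edgePerm)) y ∈
      ({a} : Set _) := ha ▸ ⟨y, hy, rfl⟩
  exact Quotient.exact (h1.trans h2.symm)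

/-- The faces of `G_P`, as regions of the whole graph. -/
noncomputable def faceRegions :
    Regions G.rotP G.edgePerm Finset.univ (Fin G.facesP.num) where
  reg := G.facesP.face
  chi := G.facesP.chi
  chi_le_one f := by
    have h1 := G.one_le_numBoundary f
    unfold Faces.chi
    omega
  reg_edge y := by
    simpa [nextCorner] using G.facesP.face_nextCorner (G.rotP.symm y)
  reg_edge_of_notMem y hy := (hy (Finset.mem_univ y)).elim
  eq_of_chi_eq_one f hf w _ hs x y hx hy := by
    obtain ⟨n, rfl⟩ := (G.sameCycle_of_isDisk (G.isDisk_of_chi_eq_one hf) hx hy).exists_nat_pow_eq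
    clear hy
    induction n with
    | zero => rfl
    | succ n ih =>
      rw [ih, pow_succ', Equiv.Perm.mul_apply]
      set z := ((nextCorner G.rotP G.edgePerm) ^ n) x with hz
      have hzf : G.facesP.face z = f := by
        rw [hz]
        clear ih hz
        induction n with
        | zero => exact hx
        | succ n ih => rw [pow_succ', Equiv.Perm.mul_apply, G.facesP.face_nextCorner, ih]
      have := hs (G.rotP z) (Finset.mem_univ _)
        ((G.facesP.face_nextCorner z).trans hzf)
      rw [Equiv.symm_apply_apply] at this
      exact this.symm

lemma two_mul_numEdges : 2 * G.numEdges = Fintype.card (Point p q Δ) := by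
  have h1 : Fintype.card {x : Point p q Δ // ¬ G.sign x = 1} = G.numEdges := by
    refine (Fintype.card_congr ?_).symm
    refine G.arc.trans (Equiv.subtypeEquivRight fun x => ?_)
    change G.sign x = -1 ↔ _
    rcases Int.units_eq_one_or (G.sign x) with h | h <;> rw [h] <;> decide
  have h2 := Fintype.card_congr (Equiv.sumCompl fun x : Point p q Δ => G.sign x = 1)
  rw [Fintype.card_sum, h1] at h2
  rw [← h2]
  unfold ArcSystem.numEdges
  ring

/-- Euler's formula for P̂. The left side, taken for any subgraph, is unchanged by deletion of edges
and bounds the number of sides without a switch. -/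
lemma sum_chi_faceRegions :
    ((Finset.univ : Finset (Point p q Δ)).card : ℤ) - 2 * ∑ f, G.faceRegions.chi f =
      2 * (p - G.chiP) := by
  have h1 := G.two_mul_numEdges
  rw [Finset.card_univ, ← h1]
  change _ - 2 * ∑ f, G.facesP.chi f = _
  unfold chiP
  push_cast
  ring

/-- A disk face with constant corner signs represents the type. -/
lemma faceRepresents_of_cornerSign {τ : Fin q → ℤˣ} {D : Fin G.facesP.num}
    (hD : G.facesP.IsDisk D)
    (h : ∀ x y, G.facesP.face x = D → G.facesP.face y = D →
      G.cornerSign τ x = G.cornerSign τ y) : G.FaceRepresents D τ := by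
  classical
  obtain ⟨x₀, hx₀⟩ := G.facesP.face_surjective D
  -- The common corner sign. All corners of `D` in one interval then have the same sign, so nothing
  -- cancels in `cornerSum`.
  set η : ℤˣ := G.signP x₀.1 * τ (G.interval x₀) with hη
  have hs : ∀ x, G.facesP.face x = D → G.signP x.1 = η * τ (G.interval x) := by
    intro x hx
    have h1 := Units.ext (h x x₀ hx hx₀)
    rw [hη, ← h1, mul_assoc, Int.units_mul_self, mul_one]
  have hsum : ∀ j, G.cornerSum D j = ((η * τ j : ℤˣ) : ℤ) *
      ((Finset.univ.filter fun x => G.facesP.face x = D ∧ G.interval x = j).card : ℤ) := by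
    intro j
    unfold cornerSum
    rw [← Finset.sum_boole, Finset.mul_sum]
    refine Finset.sum_congr rfl fun x _ => ?_
    by_cases hx : G.facesP.face x = D ∧ G.interval x = j
    · rw [if_pos hx, if_pos hx, mul_one, hs x hx.1, hx.2]
    · rw [if_neg hx, if_neg hx, mul_zero]
  refine ⟨hD, ⟨⟨η, fun j hj => ?_⟩, ?_⟩, fun x y hx hy hxy => by rw [hs x hx, hs y hy, hxy]⟩
  · rw [hsum j] at hj ⊢
    have hpos : Int.sign ((Finset.univ.filter fun x => G.facesP.face x = D ∧
        G.interval x = j).card : ℤ) = 1 :=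
      Int.sign_eq_one_of_pos (lt_of_le_of_ne (Int.natCast_nonneg _) (right_ne_zero_of_mul hj).symm)
    rw [Int.sign_mul, hpos, mul_one]
    rcases Int.units_eq_one_or (η * τ j) with h' | h' <;> rw [h'] <;> rfl
  · have h1 : ∀ j, |G.cornerSum D j| =
        ((Finset.univ.filter fun x => G.facesP.face x = D ∧ G.interval x = j).card : ℤ) := by
      intro j
      rw [hsum j, abs_mul, Nat.abs_cast]
      rcases Int.units_eq_one_or (η * τ j) with h' | h' <;> rw [h'] <;> simp
    have h2 : ∑ j, (Finset.univ.filter fun x => G.facesP.face x = D ∧ G.interval x = j).card =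
        (Finset.univ.filter fun x => G.facesP.face x = D).card := by
      rw [Finset.card_eq_sum_card_fiberwise (f := G.interval) (t := Finset.univ) (by simp)]
      simp only [Finset.filter_filter]
    simp only [h1]
    rw [← Nat.cast_sum, h2]
    -- A second corner exists because `D` is not bounded by a trivial loop.
    have h3 : 1 < (Finset.univ.filter fun x => G.facesP.face x = D).card :=
      Finset.one_lt_card.2 ⟨x₀, by simpa using hx₀, nextCorner G.rotP G.edgePerm x₀,
        by simpa [G.facesP.face_nextCorner] using hx₀,
        (G.noTrivialLoopP x₀ (by rw [hx₀]; exact hD)).symm⟩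
    exact_mod_cast h3

/-! ### Webs from sets of labels -/

/-- A set of labels of the same sign spans a web, if few edges leave it. -/
lemma exists_web_of_labels (V : Fin q → Prop) [DecidablePred V] (hV : ∃ j, V j)
    (hs : ∀ j j', V j → V j' → G.signQ j = G.signQ j') (k : ℤ)
    (hk : ∑ y : Point p q Δ, (if V y.2.1 ∧ ¬ V (G.edgePerm y).2.1 then (1 : ℤ) else 0) ≤ k) :
    ∃ Λ : G.SubgraphQ, G.IsWeb Λ k := by
  obtain ⟨j₀, hj₀⟩ := hV
  refine ⟨⟨Finset.univ.filter V, Finset.univ.filter fun y => V y.2.1 ∧ V (G.otherEnd y).2.1,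
    ⟨j₀, by simpa using hj₀⟩, fun x hx => ?_, fun x hx => ?_⟩, fun j hj j' hj' => ?_, ?_⟩
  · simp only [Finset.mem_filter, Finset.mem_univ, true_and] at hx ⊢
    rw [G.otherEnd_involutive x]
    exact hx.symm
  · simp only [Finset.mem_filter, Finset.mem_univ, true_and] at hx ⊢
    exact hx.1
  · simp only [Finset.mem_filter, Finset.mem_univ, true_and] at hj hj'
    exact hs j j' hj hj'
  · rw [Finset.sum_boole] at hk
    refine le_trans ?_ hk
    rw [Nat.cast_le]
    refine Finset.card_le_card fun y hy => ?_
    simp only [Finset.mem_filter, Finset.mem_univ, true_and, not_and] at hy ⊢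
    exact ⟨hy.1, hy.2 hy.1⟩

/-! ### Types that have switches on all regions -/

/-- There is a subgraph of `G_P`, containing all edges with an endpoint at which the signs of `σ`
change, such that each disk region of it has at least two sides at which the corner
signs change. -/
def HasSwitchRegions (σ : Fin q → ℤˣ) : Prop :=
  ∃ (S : Finset (Point p q Δ)) (R : Regions G.rotP G.edgePerm S (Fin G.facesP.num)),
    (∀ y ∈ S, G.edgePerm y ∈ S) ∧ (∀ y, y ∉ S → σ (y.2.1 - 1) = σ y.2.1) ∧
    (S.card : ℤ) - 2 * ∑ E, R.chi E = 2 * (p - G.chiP) ∧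
    ∀ E, 2 * R.chi E ≤ ∑ z, if R.reg (G.edgePerm z) = E then
      (if z ∈ S ∧ G.cornerSign σ (G.edgePerm z) ≠ G.cornerSign σ (G.rotP.symm z) then (1 : ℤ)
        else 0) else 0

/-- Negation exchanges rises and falls, so that arguments about falls also serve for rises. -/
lemma HasSwitchRegions.neg {σ : Fin q → ℤˣ} (h : G.HasSwitchRegions σ) :
    G.HasSwitchRegions (-σ) := by
  obtain ⟨S, R, h1, h2, h3, h4⟩ := h
  refine ⟨S, R, h1, fun y hy => ?_, h3, ?_⟩
  · simp [h2 y hy]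
  · simpa only [cornerSign_neg, ne_eq, neg_inj] using h4

/-- The faces of `G_P` have switches of each type that is not represented. -/
lemma two_mul_chi_le_of_not_faceRepresents {τ : Fin q → ℤˣ} (h : ¬ ∃ D, G.FaceRepresents D τ)
    (E : Fin G.facesP.num) :
    2 * G.faceRegions.chi E ≤ ∑ z, if G.faceRegions.reg (G.edgePerm z) = E then
      (if z ∈ Finset.univ ∧ G.cornerSign τ (G.edgePerm z) ≠ G.cornerSign τ (G.rotP.symm z)
        then (1 : ℤ) else 0) else 0 := by
  have h1 := G.faceRegions.chi_le_one E
  by_contra! hlt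
  have hnn := Finset.sum_nonneg (s := (Finset.univ : Finset (Point p q Δ)))
    (f := fun z => if G.faceRegions.reg (G.edgePerm z) = E then
      (if z ∈ Finset.univ ∧ G.cornerSign τ (G.edgePerm z) ≠ G.cornerSign τ (G.rotP.symm z)
        then (1 : ℤ) else 0) else 0) (fun z _ => by positivity)
  -- The number of switches is nonnegative, so only a disk can violate the bound.
  have h2 : G.faceRegions.chi E = 1 := by omega
  refine h ⟨E, G.faceRepresents_of_cornerSign (G.isDisk_of_chi_eq_one h2) ?_⟩
  exact G.faceRegions.eq_of_sum_switch_lt_two G.edgePerm_involutive (by simp) h2 _ (by simp)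
    (by rw [h2] at hlt; exact hlt)

lemma hasSwitchRegions_of_not_faceRepresents {τ : Fin q → ℤˣ}
    (h : ¬ ∃ D, G.FaceRepresents D τ) : G.HasSwitchRegions τ :=
  ⟨Finset.univ, G.faceRegions, by simp, by simp, G.sum_chi_faceRegions,
    G.two_mul_chi_le_of_not_faceRepresents h⟩

/-- The three kinds of edge-endpoints. -/
lemma cornerSign_cases {σ : Fin q → ℤˣ} {S : Finset (Point p q Δ)}
    (hS : ∀ y, y ∉ S → σ (y.2.1 - 1) = σ y.2.1) (y : Point p q Δ) :
    (Rises σ y.2.1 ∧ ¬ Falls σ y.2.1 ∧ y ∈ S ∧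
      G.cornerSign σ (G.rotP.symm y) = -1 ∧ G.cornerSign σ y = 1) ∨
    (¬ Rises σ y.2.1 ∧ Falls σ y.2.1 ∧ y ∈ S ∧
      G.cornerSign σ (G.rotP.symm y) = 1 ∧ G.cornerSign σ y = -1) ∨
    (¬ Rises σ y.2.1 ∧ ¬ Falls σ y.2.1 ∧
      G.cornerSign σ (G.rotP.symm y) = G.cornerSign σ y ∧
      (G.cornerSign σ y = 1 ∨ G.cornerSign σ y = -1)) := by
  by_cases hr : Rises σ y.2.1
  · refine .inl ⟨hr, hr.not_falls, ?_, G.cornerSign_of_rises hr⟩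
    by_contra hy
    have e := hS y hy
    rw [hr.1, hr.2] at e
    exact absurd e (by decide)
  by_cases hf : Falls σ y.2.1
  · refine .inr (.inl ⟨hr, hf, ?_, G.cornerSign_of_falls hf⟩)
    by_contra hy
    have e := hS y hy
    rw [hf.1, hf.2] at e
    exact absurd e (by decide)
  · exact .inr (.inr ⟨hr, hf, (G.cornerSign_of_eq (eq_of_not_rises_of_not_falls hr hf)).1,
      G.cornerSign_eq_or σ y⟩)

lemma edgePerm_mem_iff {S : Finset (Point p q Δ)} (hS : ∀ y ∈ S, G.edgePerm y ∈ S)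
    (y : Point p q Δ) : G.edgePerm y ∈ S ↔ y ∈ S :=
  ⟨fun h => by simpa [G.edgePerm_involutive y] using hS _ h, hS y⟩

/-- If a type has switches on all regions, then few edges at its rises and falls do not join
a rise with a rise or a fall with a fall. -/
lemma HasSwitchRegions.sum_le {σ : Fin q → ℤˣ} (h : G.HasSwitchRegions σ) :
    ∑ y : Point p q Δ, (if Rises σ y.2.1 ∧ ¬ Rises σ (G.edgePerm y).2.1 then (1 : ℤ) else 0) +
    ∑ y : Point p q Δ, (if Falls σ y.2.1 ∧ ¬ Falls σ (G.edgePerm y).2.1 then (1 : ℤ) else 0) ≤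
      2 * (p - G.chiP) := by
  obtain ⟨S, R, h1, h2, h3, h4⟩ := h
  rw [← h3, ← Finset.sum_add_distrib]
  refine le_trans (sum_le_sum_of_edge G.edgePerm _ _ fun y => ?_) (R.sum_nonswitch_le _ h4)
  have hS := G.edgePerm_mem_iff h1 y
  have k1 := G.cornerSign_cases h2 y
  have k2 := G.cornerSign_cases h2 (G.edgePerm y)
  rw [hS] at k2
  have hee : G.edgePerm (G.edgePerm y) = y := G.edgePerm_involutive y
  simp only [hee, hS]
  -- An edge from a rise to a fall has no switch on either side. An edge from a rise or a fall to a
  -- label of neither kind has exactly one side without a switch.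
  rcases k1 with ⟨r1, f1, s1, a1, b1⟩ | ⟨r1, f1, s1, a1, b1⟩ | ⟨r1, f1, a1, b1 | b1⟩ <;>
  rcases k2 with ⟨r2, f2, s2, a2, b2⟩ | ⟨r2, f2, s2, a2, b2⟩ | ⟨r2, f2, a2, b2 | b2⟩ <;>
  simp [*] <;> positivity

/-! ### Derived types and the descent. -/

/-- The type derived from a type with switches on all regions has the same property. -/
lemma HasSwitchRegions.derived {σ σ' : Fin q → ℤˣ} (h : G.HasSwitchRegions σ)
    (hr : ∀ j, ¬ Rises σ j → σ' (j - 1) = σ' j) (hf : ∀ j, Falls σ j → σ' j = G.signQ j) :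
    G.HasSwitchRegions σ' := by
  obtain ⟨S, R, h1, h2, h3, h4⟩ := h
  have he := G.edgePerm_involutive
  -- `σ'` changes only at rises of `σ`, so the edges without an end at a rise can be deleted.
  set S' : Finset (Point p q Δ) :=
    Finset.univ.filter fun y => Rises σ y.2.1 ∨ Rises σ (G.edgePerm y).2.1 with hS'
  have memS' : ∀ y, y ∈ S' ↔ Rises σ y.2.1 ∨ Rises σ (G.edgePerm y).2.1 := by simp [hS']
  have hS'e : ∀ y ∈ S', G.edgePerm y ∈ S' := by
    intro y hy
    rw [memS'] at hy ⊢
    rw [he y]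
    exact hy.symm
  have hSS : S' ⊆ S := by
    intro y hy
    rcases (memS' y).1 hy with hy | hy
    · rcases G.cornerSign_cases h2 y with k | k | k
      exacts [k.2.2.1, (k.1 hy).elim, (k.1 hy).elim]
    · rcases G.cornerSign_cases h2 (G.edgePerm y) with k | k | k
      exacts [(G.edgePerm_mem_iff h1 y).1 k.2.2.1, (k.1 hy).elim, (k.1 hy).elim]
  have hnot : ∀ y, y ∉ S' → ¬ Rises σ y.2.1 := fun y hy h => hy ((memS' y).2 (.inl h))
  have hσ' : ∀ y : Point p q Δ, y ∉ S' → σ' (y.2.1 - 1) = σ' y.2.1 :=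
    fun y hy => hr _ (hnot y hy)
  obtain ⟨R', hR', hg⟩ := R.exists_restrict he G.edgePerm_ne S' hS'e S hSS h1
  refine ⟨S', R', hS'e, hσ', by linarith, fun E => ?_⟩
  by_contra! hlt
  have hnn := Finset.sum_nonneg (s := (Finset.univ : Finset (Point p q Δ)))
    (f := fun z => if R'.reg (G.edgePerm z) = E then
      (if z ∈ S' ∧ G.cornerSign σ' (G.edgePerm z) ≠ G.cornerSign σ' (G.rotP.symm z)
        then (1 : ℤ) else 0) else 0) (fun z _ => by positivity)
  have hE : R'.chi E = 1 := by
    have := R'.chi_le_one E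
    omega
  have hconst := R'.eq_of_sum_switch_lt_two he hS'e hE (G.cornerSign σ')
    (fun y hy => (G.cornerSign_of_eq (hσ' y hy)).1) (by rw [hE] at hlt; exact hlt)
  -- This is the reason for choosing `signQ` at the falls: the new corner sign is the sign of the
  -- intersection point, which differs at the two ends of an arc.
  have hfall : ∀ y, Falls σ y.2.1 → G.cornerSign σ' y = (G.sign y : ℤ) := by
    intro y hy
    rw [(G.cornerSign_of_eq (hr _ fun h => h.not_falls hy)).2, hf _ hy]
    rfl
  have hside : ∀ y, y ∉ S' → R'.reg (G.edgePerm y) = R'.reg y := R'.reg_edge_of_notMem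
  have hmem' := G.edgePerm_mem_iff hS'e
  -- no edge inside the region joins two falls
  have hff : ∀ y, y ∉ S' → R'.reg (G.edgePerm y) = E → Falls σ y.2.1 →
      ¬ Falls σ (G.edgePerm y).2.1 := by
    intro y hy hyE hy1 hy2
    have e := hconst y (G.edgePerm y) ((hside y hy).symm.trans hyE) hyE
    rw [hfall y hy1, hfall _ hy2] at e
    have e' : G.sign (G.edgePerm y) = - G.sign y := G.sign_otherEnd y
    rw [e'] at e
    rcases Int.units_eq_one_or (G.sign y) with h | h <;> rw [h] at e <;> exact absurd e (by decide)
  -- the sides on the boundary at which the corner signs change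
  have hcount : ∑ z, (if R'.reg (G.edgePerm z) = E ∧ z ∈ S' ∧
        G.cornerSign σ (G.edgePerm z) ≠ G.cornerSign σ (G.rotP.symm z) then (1 : ℤ) else 0) =
      ∑ z, (if R'.reg (G.edgePerm z) = E ∧ z ∉ S' ∧ Falls σ z.2.1 then (1 : ℤ) else 0) := by
    -- Around the region the old corner sign has total change 0. It goes up by 2 at each switch on
    -- the boundary, and down by 2 at each fall at a deleted endpoint.
    have e1 := R'.sum_change_eq_zero E (G.cornerSign σ)
    have e2 := R'.sum_notMem_edge he E S'ᶜ (by simp [hmem']) (by simp) (G.cornerSign σ)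
    rw [← sub_eq_zero, ← Finset.sum_sub_distrib] at e2
    rw [← sub_eq_zero, ← Finset.sum_sub_distrib]
    have e3 := congrArg₂ (· - ·) e1 e2
    simp only [← Finset.sum_sub_distrib, sub_zero] at e3
    refine (mul_eq_zero.1 (Eq.trans ?_ e3)).resolve_left (two_ne_zero (α := ℤ))
    rw [Finset.mul_sum]
    refine Finset.sum_congr rfl fun z _ => ?_
    by_cases hzE : R'.reg (G.edgePerm z) = E
    · by_cases hz : z ∈ S'
      · have hup : G.cornerSign σ (G.rotP.symm z) = -1 ∨ G.cornerSign σ (G.edgePerm z) = 1 :=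
          ((memS' z).1 hz).imp (fun h => (G.cornerSign_of_rises h).1)
            fun h => (G.cornerSign_of_rises h).2
        simp only [hzE, hz, Finset.mem_compl, true_and, and_false, not_true, false_and, if_true,
          if_false, sub_zero]
        rcases G.cornerSign_eq_or σ (G.rotP.symm z) with a | a <;>
        rcases G.cornerSign_eq_or σ (G.edgePerm z) with d | d <;>
        rw [a, d] at hup ⊢ <;> revert hup <;> decide
      · simp only [hzE, hz, Finset.mem_compl, true_and, and_true, false_and, not_false_iff, if_true,
          if_false]
        rcases G.cornerSign_cases h2 z with ⟨r, f, -, a, b⟩ | ⟨r, f, -, a, b⟩ | ⟨r, f, a, -⟩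
        · exact (hnot z hz r).elim
        · rw [if_pos f, a, b]; ring
        · rw [if_neg f, a]; ring
    · simp [hzE]
  have hinner : ∑ z, (if R'.reg (G.edgePerm z) = E ∧ z ∉ S' ∧ Falls σ z.2.1
        then (1 : ℤ) else 0) ≤
      ∑ z, (if R'.reg (G.edgePerm z) = E ∧ z ∈ S ∧ z ∉ S' ∧
        G.cornerSign σ (G.edgePerm z) = G.cornerSign σ (G.rotP.symm z) then (1 : ℤ) else 0) := by
    -- A deleted edge in the region with an end at a fall has its other end at neither a rise nor a
    -- fall, so exactly one of its sides lacks a switch.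
    refine sum_le_sum_of_edge G.edgePerm _ _ fun z => ?_
    simp only [he z, hmem', G.edgePerm_mem_iff h1]
    by_cases hz : z ∈ S'
    · simp [hz]
    rw [← hside z hz]
    by_cases hzE : R'.reg (G.edgePerm z) = E
    · have hz' : G.edgePerm z ∉ S' := by rwa [hmem']
      simp only [hzE, hz, true_and, not_false_iff]
      rcases G.cornerSign_cases h2 z with ⟨r, -⟩ | ⟨-, f, s, a, b⟩ | ⟨-, f, a, c⟩
      · exact (hnot z hz r).elim
      · rcases G.cornerSign_cases h2 (G.edgePerm z) with ⟨r, -⟩ | ⟨-, f', -⟩ | ⟨-, f', a', c'⟩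
        · exact (hnot _ hz' r).elim
        · exact (hff z hz hzE f f').elim
        · rw [a, b, a']
          rcases c' with c' | c' <;> rw [c'] <;> simp [f, f', s]
      · rcases G.cornerSign_cases h2 (G.edgePerm z) with ⟨r, -⟩ | ⟨-, f', s', a', b'⟩ | ⟨-, f', -⟩
        · exact (hnot _ hz' r).elim
        · rw [G.edgePerm_mem_iff h1] at s'
          rw [a', b', a]
          rcases c with c | c <;> rw [c] <;> simp [f, f', s']
        · simp only [f, f', if_false, add_zero]
          positivity
    · simp [hzE]
  -- After the deletions the bound on 2χ is the number of boundary switches minus the number of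
  -- deleted sides without a switch. By the two counts it is at most 0, but χ is 1.
  have hfin := hg (fun z => if z ∈ S ∧ G.cornerSign σ (G.edgePerm z) ≠
    G.cornerSign σ (G.rotP.symm z) then 1 else 0) h4 E
  have hsplit : ∑ z, (if R'.reg (G.edgePerm z) = E then
      (if z ∈ S ∧ G.cornerSign σ (G.edgePerm z) ≠ G.cornerSign σ (G.rotP.symm z)
        then (1 : ℤ) else 0) - (if z ∈ S ∧ z ∉ S' then 1 else 0) else 0) =
      ∑ z, (if R'.reg (G.edgePerm z) = E ∧ z ∈ S' ∧
        G.cornerSign σ (G.edgePerm z) ≠ G.cornerSign σ (G.rotP.symm z) then (1 : ℤ) else 0) -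
      ∑ z, (if R'.reg (G.edgePerm z) = E ∧ z ∈ S ∧ z ∉ S' ∧
        G.cornerSign σ (G.edgePerm z) = G.cornerSign σ (G.rotP.symm z) then (1 : ℤ) else 0) := by
    rw [← Finset.sum_sub_distrib]
    refine Finset.sum_congr rfl fun z _ => ?_
    by_cases hzE : R'.reg (G.edgePerm z) = E
    · by_cases hz : z ∈ S'
      · simp [hzE, hz, hSS hz]
      · by_cases hzS : z ∈ S <;>
        by_cases hsw : G.cornerSign σ (G.edgePerm z) = G.cornerSign σ (G.rotP.symm z) <;>
        simp [hzE, hz, hzS, hsw]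
    · simp [hzE]
  rw [hsplit, hE] at hfin
  linarith

/-- A non-constant type with switches on all regions gives a web. -/
lemma HasSwitchRegions.exists_web {σ : Fin q → ℤˣ} (h : G.HasSwitchRegions σ)
    (hp : ∃ j, σ j = 1) (hn : ∃ j, σ j = -1) :
    ∃ Λ : G.SubgraphQ, G.IsWeb Λ ((p : ℤ) - G.chiP) := by
  induction hN : (Finset.univ.filter fun j => Rises σ j ∨ Falls σ j).card
    using Nat.strong_induction_on generalizing σ with
  | _ N ih =>
  subst hN
  -- Mixed signs at the falls make the derived type non-constant, and it changes only at rises of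
  -- `ρ`, so the falls disappear from the count. `ρ` will be `σ` or `-σ`.
  have mixed : ∀ ρ : Fin q → ℤˣ, G.HasSwitchRegions ρ → (∃ j, ρ j = 1) → (∃ j, ρ j = -1) →
      (Finset.univ.filter fun j => Rises ρ j ∨ Falls ρ j).card =
        (Finset.univ.filter fun j => Rises σ j ∨ Falls σ j).card →
      (¬ ∀ j j', Falls ρ j → Falls ρ j' → G.signQ j = G.signQ j') →
      ∃ Λ : G.SubgraphQ, G.IsWeb Λ ((p : ℤ) - G.chiP) := by
    intro ρ hρ hp hn hcard hmix
    obtain ⟨ρ', hr, hf⟩ := exists_derived hp hn G.signQ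
    push Not at hmix
    obtain ⟨j, j', hj, hj', hne⟩ := hmix
    rw [← hf j hj, ← hf j' hj'] at hne
    have hlt : (Finset.univ.filter fun j => Rises ρ' j ∨ Falls ρ' j).card <
        (Finset.univ.filter fun j => Rises σ j ∨ Falls σ j).card := by
      rw [← hcard]
      refine Finset.card_lt_card ((Finset.ssubset_iff_of_subset fun i hi => ?_).2 ⟨j, ?_, ?_⟩)
      · simp only [Finset.mem_filter, Finset.mem_univ, true_and] at hi ⊢
        by_contra hi'
        have e := hr i fun h => hi' (.inl h)
        rcases hi with hi | hi <;> rw [hi.1, hi.2] at e <;> exact absurd e (by decide)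
      · simp [hj]
      · simp only [Finset.mem_filter, Finset.mem_univ, true_and]
        intro hi
        have e := hr j fun h => h.not_falls hj
        rcases hi with hi | hi <;> rw [hi.1, hi.2] at e <;> exact absurd e (by decide)
    have hboth : (∃ j, ρ' j = 1) ∧ ∃ j, ρ' j = -1 := by
      rcases Int.units_eq_one_or (ρ' j) with e | e <;>
      rcases Int.units_eq_one_or (ρ' j') with e' | e'
      · exact (hne (e.trans e'.symm)).elim
      · exact ⟨⟨j, e⟩, ⟨j', e'⟩⟩
      · exact ⟨⟨j', e'⟩, ⟨j, e⟩⟩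
      · exact (hne (e.trans e'.symm)).elim
    exact ih _ hlt (hρ.derived G hr hf) hboth.1 hboth.2 rfl
  by_cases hfall : ∀ j j', Falls σ j → Falls σ j' → G.signQ j = G.signQ j'
  · by_cases hrise : ∀ j j', Rises σ j → Rises σ j' → G.signQ j = G.signQ j'
    · have hle := h.sum_le
      -- The two counts add up to at most twice the bound, so one of them is within it.
      rcases le_or_gt (∑ y : Point p q Δ, (if Rises σ y.2.1 ∧ ¬ Rises σ (G.edgePerm y).2.1
        then (1 : ℤ) else 0)) (p - G.chiP) with hk | hk
      · exact G.exists_web_of_labels _ (exists_rises hp hn) hrise _ hk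
      · exact G.exists_web_of_labels _ (exists_falls hp hn) hfall _ (by linarith)
    · refine mixed (-σ) h.neg (hn.imp fun j e => by simp [e]) (hp.imp fun j e => by simp [e])
        ?_ (by simpa only [falls_neg] using hrise)
      simp only [rises_neg, falls_neg, or_comm]
  · exact mixed σ h hp hn rfl hfall

/-- If a constant type is not represented, then the vertices of `G_Q` of one sign span a web. -/
lemma exists_web_of_const {τ : Fin q → ℤˣ} (h : ¬ ∃ D, G.FaceRepresents D τ)
    (hτ : ∀ j j', τ j = τ j') : ∃ Λ : G.SubgraphQ, G.IsWeb Λ ((p : ℤ) - G.chiP) := by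
  have hle := G.faceRegions.sum_nonswitch_le _ (G.two_mul_chi_le_of_not_faceRepresents h)
  rw [G.sum_chi_faceRegions] at hle
  refine G.exists_web_of_labels (fun j => G.signQ j = G.signQ 0) ⟨0, rfl⟩
    (fun j j' hj hj' => hj.trans hj'.symm) _ ?_
  -- An edge joining opposite signs has one endpoint at the chosen sign, but two sides without a
  -- switch.
  suffices hs : 2 * ∑ y : Point p q Δ, (if G.signQ y.2.1 = G.signQ 0 ∧
      ¬ G.signQ (G.edgePerm y).2.1 = G.signQ 0 then (1 : ℤ) else 0) ≤ 2 * (p - G.chiP) by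
    linarith
  refine le_trans ?_ hle
  rw [Finset.mul_sum]
  refine sum_le_sum_of_edge G.edgePerm _ _ fun y => ?_
  have hsw : ∀ z : Point p q Δ, G.cornerSign τ (G.edgePerm z) = G.cornerSign τ (G.rotP.symm z) ↔
      G.signQ (G.edgePerm z).2.1 = - G.signQ z.2.1 := by
    intro z
    rw [(G.cornerSign_of_eq (hτ _ _)).1, (G.cornerSign_of_eq (hτ _ _)).2,
      (G.cornerSign_of_eq (hτ _ _)).2, hτ (G.edgePerm z).2.1 z.2.1, Units.val_inj, mul_left_inj]
    exact G.parity_rule z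
  have hee : G.edgePerm (G.edgePerm y) = y := G.edgePerm_involutive y
  have s1 := hsw y
  have s2 := hsw (G.edgePerm y)
  rw [hee] at s2
  simp only [s1, s2, hee, Finset.mem_univ, true_and]
  rcases Int.units_eq_one_or (G.signQ 0) with e | e <;>
  rcases Int.units_eq_one_or (G.signQ y.2.1) with e1 | e1 <;>
  rcases Int.units_eq_one_or (G.signQ (G.edgePerm y).2.1) with e2 | e2 <;>
  simp [e, e1, e2]

end GraphPair

end IntersectionGraphs

theorem theorem5p1 (p q Δ : ℕ) [NeZero p] [NeZero q] [NeZero Δ]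
    (G : IntersectionGraphs.GraphPair p q Δ)
    (hΔ : (Δ : ℝ) > 1 - (G.chiP : ℝ) / (p : ℝ)) :
    G.RepresentsAllTypes ∨
      ∃ Λ : G.SubgraphQ, G.IsWeb Λ ((p : ℤ) - G.chiP) := by
  by_cases h : G.RepresentsAllTypes
  · exact .inl h
  refine .inr ?_
  obtain ⟨τ, hτ⟩ := not_forall.1 h
  by_cases hc : ∀ j j', τ j = τ j'
  · exact G.exists_web_of_const hτ hc
  push Not at hc
  obtain ⟨j, j', hne⟩ := hc
  have hboth : (∃ j, τ j = 1) ∧ ∃ j, τ j = -1 := by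
    rcases Int.units_eq_one_or (τ j) with e | e <;>
    rcases Int.units_eq_one_or (τ j') with e' | e'
    · exact (hne (e.trans e'.symm)).elim
    · exact ⟨⟨j, e⟩, ⟨j', e'⟩⟩
    · exact ⟨⟨j', e'⟩, ⟨j, e⟩⟩
    · exact (hne (e.trans e'.symm)).elim
  exact (G.hasSwitchRegions_of_not_faceRepresents hτ).exists_web G hboth.1 hboth.2
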